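/- Let $k\ge 0$, let $\Xi\subset\mathbb{R}^k$ be a compact set with positive Lebesgue measure, let $f:\Xi\to\mathbb{R}$ be continuous, let $\mu_0\in\mathbb{R}^k$, let $\Sigma_0\in\mathbb{R}^{k\times k}$ be symmetric positive definite, and let $m_1,m_2,\varepsilon>0$. Let $\mathcal{P}(\Xi)$ be the set of (Borel) probability measures on $\Xi$, and let $\mathbb{Q}_0\in\mathcal{P}(\Xi)$ be the Gaussian law with mean $\mu_0$ and covariance $\Sigma_0$ restricted to $\Xi$ and normalized, that is $$\mathrm{d}\mathbb{Q}_0(\xi)=\alpha\, e^{-\frac12(\xi-\mu_0)\cdot\Sigma_0^{-1}(\xi-\mu_0)}\,\mathbf{1}_\Xi(\xi)\,\mathrm{d}\xi ,\qquad \alpha=\Big(\int_\Xi e^{-\frac12(\xi-\mu_0)\cdot\Sigma_0^{-1}(\xi-\mu_0)}\,\mathrm{d}\xi\Big)^{-1}.$$ For $\mathbb{Q}\in\mathcal{P}(\Xi)$ let $H(\mathbb{Q})=\int_\Xi\log\frac{\mathrm{d}\mathbb{Q}}{\mathrm{d}\mathbb{Q}_0}\,\mathrm{d}\mathbb{Q}\in[0,+\infty]$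 if $\mathbb{Q}$ is absolutely continuous with respect to $\mathbb{Q}_0$, and $H(\mathbb{Q})=+\infty$ otherwise. Let $$\mathcal{A}_{\mathrm M}=\Big\{\mathbb{Q}\in\mathcal{P}(\Xi):\ \Big|\int_\Xi\xi\,\mathrm{d}\mathbb{Q}(\xi)-\mu_0\Big|\le m_1\ \text{ and }\ \int_\Xi(\xi-\mu_0)\otimes(\xi-\mu_0)\,\mathrm{d}\mathbb{Q}(\xi)\le m_2\Sigma_0\Big\},$$ where $|\cdot|$ is the Euclidean norm and the second inequality is in the sense of positive semi-definite matrices. Then, as an equality in $[-\infty,+\infty)$ (with $\sup\emptyset=-\infty$), $$\sup_{\mathbb{Q}\in\mathcal{A}_{\mathrm M}}\Big(\int_\Xi f\,\mathrm{d}\mathbb{Q}-\varepsilon H(\mathbb{Q})\Big)=\inf_{\substack{\lambda\ge0,\ |\tau|\le1\\ S\in\mathbb{S}^k_+}}\Big\{\lambda m_1-\lambda\tau\cdot\mu_0+m_2\,S:\Sigma_0+\varepsilon\log\int_\Xi e^{\frac{f(\xi)+\lambda\tau\cdot\xi-S:(\xi-\mu_0)\otimes(\xi-\mu_0)}{\varepsilon}}\,\mathrm{d}\mathbb{Q}_0(\xi)\Big\},$$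 where $\tau$ ranges over $\mathbb{R}^k$, $\mathbb{S}^k_+$ is the set of symmetric positive semi-definite real $k\times k$ matrices, and $A:B=\sum_{i,j}A_{ij}B_{ij}$. -/

import Mathlib

open MeasureTheory

noncomputable section

namespace MomentDRO

/-- The Frobenius inner product `A : B = ∑ᵢⱼ Aᵢⱼ Bᵢⱼ` of two real `k × k` matrices. -/
def frob {k : ℕ} (A B : Matrix (Fin k) (Fin k) ℝ) : ℝ :=
  ∑ i, ∑ j, A i j * B i j

/-- The tensor product `x ⊗ x`, i.e. the matrix with entries `xᵢ xⱼ`. -/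
def tensorSq {k : ℕ} (x : EuclideanSpace ℝ (Fin k)) : Matrix (Fin k) (Fin k) ℝ :=
  Matrix.of fun i j => x i * x j

/-- The mean `∫ ξ dQ(ξ)` of a law `Q` on `Ξ ⊆ ℝᵏ`. -/
def mean {k : ℕ} {Ξ : Set (EuclideanSpace ℝ (Fin k))} (Q : ProbabilityMeasure Ξ) :
    EuclideanSpace ℝ (Fin k) :=
  ∫ ξ : Ξ, (ξ : EuclideanSpace ℝ (Fin k)) ∂(Q : Measure Ξ)

/-- The second moment matrix `∫ (ξ - μ₀) ⊗ (ξ - μ₀) dQ(ξ)` of `Q` about the point `μ₀`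
(the integral of a matrix-valued function is taken entrywise). -/
def secondMoment {k : ℕ} {Ξ : Set (EuclideanSpace ℝ (Fin k))}
    (μ₀ : EuclideanSpace ℝ (Fin k)) (Q : ProbabilityMeasure Ξ) : Matrix (Fin k) (Fin k) ℝ :=
  Matrix.of fun i j =>
    ∫ ξ : Ξ, tensorSq ((ξ : EuclideanSpace ℝ (Fin k)) - μ₀) i j ∂(Q : Measure Ξ)

/-- The moment-based ambiguity set: the laws `Q` on `Ξ` with `|∫ ξ dQ - μ₀| ≤ m₁` and
`∫ (ξ - μ₀) ⊗ (ξ - μ₀) dQ ≤ m₂ C₀` in the sense of positive semi-definite matrices. -/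
def ambiguitySet {k : ℕ} (Ξ : Set (EuclideanSpace ℝ (Fin k)))
    (μ₀ : EuclideanSpace ℝ (Fin k)) (C₀ : Matrix (Fin k) (Fin k) ℝ) (m₁ m₂ : ℝ) :
    Set (ProbabilityMeasure Ξ) :=
  {Q | ‖mean Q - μ₀‖ ≤ m₁ ∧ (m₂ • C₀ - secondMoment μ₀ Q).PosSemidef}

/-- The Gaussian exponent `-½ (x - μ₀)ᵀ C₀⁻¹ (x - μ₀)`. -/
def gaussianExponent {k : ℕ} (μ₀ : EuclideanSpace ℝ (Fin k))
    (C₀ : Matrix (Fin k) (Fin k) ℝ) (x : EuclideanSpace ℝ (Fin k)) : ℝ :=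
  -(1 / 2) * ∑ i, ∑ j, (x - μ₀) i * C₀⁻¹ i j * (x - μ₀) j

/-- The reference law on `Ξ`: the Gaussian distribution with center `μ₀` and covariance matrix
`C₀`, restricted to `Ξ` and normalized. It has the density
`α exp(-½ (x - μ₀)ᵀ C₀⁻¹ (x - μ₀))` with respect to the Lebesgue measure on `Ξ`, where
`α = 1 / ∫_Ξ exp(-½ (x - μ₀)ᵀ C₀⁻¹ (x - μ₀)) dx` is the constant built into
`MeasureTheory.Measure.tilted`. -/
def refLaw {k : ℕ} (Ξ : Set (EuclideanSpace ℝ (Fin k)))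
    (μ₀ : EuclideanSpace ℝ (Fin k)) (C₀ : Matrix (Fin k) (Fin k) ℝ) : Measure Ξ :=
  (Measure.comap ((↑) : Ξ → EuclideanSpace ℝ (Fin k)) volume).tilted
    fun ξ => gaussianExponent μ₀ C₀ (ξ : EuclideanSpace ℝ (Fin k))

/-- The entropy `H(Q) ∈ [0, +∞]` of `Q` with respect to the reference law `Q₀`: it is
`∫ log (dQ/dQ₀) dQ` if `Q` is absolutely continuous with respect to `Q₀`, and `+∞` otherwise.
(If `Q ≪ Q₀` but `log (dQ/dQ₀)` is not `Q`-integrable, then its integral is `+∞`, because its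
negative part is integrable; this is the convention in `InformationTheory.klDiv`.) -/
def entropy {k : ℕ} {Ξ : Set (EuclideanSpace ℝ (Fin k))}
    (μ₀ : EuclideanSpace ℝ (Fin k)) (C₀ : Matrix (Fin k) (Fin k) ℝ)
    (Q : ProbabilityMeasure Ξ) : ENNReal :=
  InformationTheory.klDiv (Q : Measure Ξ) (refLaw Ξ μ₀ C₀)

/-- The entropy-penalized expectation `∫ f dQ - ε H(Q) ∈ [-∞, +∞)`. -/
def primalValue {k : ℕ} {Ξ : Set (EuclideanSpace ℝ (Fin k))}
    (μ₀ : EuclideanSpace ℝ (Fin k)) (C₀ : Matrix (Fin k) (Fin k) ℝ) (ε : ℝ)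
    (f : Ξ → ℝ) (Q : ProbabilityMeasure Ξ) : EReal :=
  ((∫ ξ, f ξ ∂(Q : Measure Ξ) : ℝ) : EReal) - (ε : EReal) * (entropy μ₀ C₀ Q : EReal)

/-- The dual objective
`l m₁ - l τ·μ₀ + m₂ S : C₀ + ε log ∫ exp((f(ξ) + l τ·ξ - S : (ξ-μ₀)⊗(ξ-μ₀)) / ε) dQ₀(ξ)`. -/
def dualValue {k : ℕ} {Ξ : Set (EuclideanSpace ℝ (Fin k))}
    (μ₀ : EuclideanSpace ℝ (Fin k)) (C₀ : Matrix (Fin k) (Fin k) ℝ) (m₁ m₂ ε : ℝ)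
    (f : Ξ → ℝ) (l : ℝ) (τ : EuclideanSpace ℝ (Fin k)) (S : Matrix (Fin k) (Fin k) ℝ) : ℝ :=
  l * m₁ - l * inner ℝ τ μ₀ + m₂ * frob S C₀ +
    ε * Real.log (∫ ξ : Ξ,
      Real.exp ((f ξ + l * inner ℝ τ (ξ : EuclideanSpace ℝ (Fin k))
        - frob S (tensorSq ((ξ : EuclideanSpace ℝ (Fin k)) - μ₀))) / ε) ∂(refLaw Ξ μ₀ C₀))

end MomentDRO

end

/-! Weak duality is the Gibbs variational inequality for the exponent `(f - ψ) / ε`, where `ψ` is a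
linear penalty in the first and second moments: feasibility bounds the mean of `ψ` by the constants
in the dual objective.

For the converse, every real `c` strictly above all primal values must dominate some dual value,
even if no law is feasible. Laws of finite entropy are identified with their `L¹` densities. On
these the penalized mean is concave and bounded above, and the moments are a continuous linear map
into a finite-dimensional space. No Slater condition is needed: the penalized mean is uniformly
concave in the `L¹` norm and has closed superlevel sets, so near-maximizers under shrinking
relaxations of the constraint form a Cauchy sequence, and their limit is feasible. Hence nearly
feasible densities also stay below `c` by a margin, which leaves room for an open convex set to be
separated from the hypograph (`exists_multiplier`).

The resulting functional `φ` is turned into `l`, `τ`, `S` by the support function of the moment set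
(`exists_dual_parameters`). Testing the multiplier inequality on the Gibbs density produces the
logarithmic integral (`exists_integral_sub_entropy_eq_log_integral_exp`). -/

namespace EntropicDuality

open Filter Topology

/-! ### Lagrange multipliers for uniformly concave functions. -/

section Abstract

variable {E F : Type*} [NormedAddCommGroup E] [NormedSpace ℝ E]
  [NormedAddCommGroup F] [NormedSpace ℝ F]

/-- The points of `D` whose image under `T` is within distance `δ` of `C`. -/
def nearFeasible (D : Set E) (T : E →L[ℝ] F) (C : Set F) (δ : ℝ) : Set E :=
  {a | a ∈ D ∧ ∃ y ∈ C, ‖T a - y‖ < δ}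

theorem nearFeasible_mono {D : Set E} {T : E →L[ℝ] F} {C : Set F} {δ δ' : ℝ} (h : δ ≤ δ') :
    nearFeasible D T C δ ⊆ nearFeasible D T C δ' :=
  fun _ ⟨ha, y, hy, hay⟩ => ⟨ha, y, hy, hay.trans_le h⟩

theorem midpoint_mem_nearFeasible {D : Set E} {T : E →L[ℝ] F} {C : Set F} {δ : ℝ}
    (hD : Convex ℝ D) (hC : Convex ℝ C) {a b : E} (ha : a ∈ nearFeasible D T C δ)
    (hb : b ∈ nearFeasible D T C δ) : midpoint ℝ a b ∈ nearFeasible D T C δ := by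
  obtain ⟨haD, y, hy, hay⟩ := ha
  obtain ⟨hbD, z, hz, hbz⟩ := hb
  refine ⟨hD.midpoint_mem haD hbD, midpoint ℝ y z, hC.midpoint_mem hy hz, ?_⟩
  have h : T (midpoint ℝ a b) - midpoint ℝ y z = (2⁻¹ : ℝ) • ((T a - y) + (T b - z)) := by
    simp only [midpoint_eq_smul_add, map_smul, map_add, invOf_eq_inv]
    module
  rw [h, norm_smul, Real.norm_of_nonneg (by norm_num)]
  have := norm_add_le (T a - y) (T b - z)
  linarith

/-- For a uniformly concave function with closed superlevel sets, approximate feasibility at level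
`c` implies feasibility at level `c`. -/
theorem exists_feasible_of_nearFeasible [CompleteSpace E] {D : Set E} {J : E → ℝ}
    (hD : Convex ℝ D) (hbdd : BddAbove (J '' D)) (hcl : ∀ r, IsClosed {a | a ∈ D ∧ r ≤ J a})
    (huc : ∀ η > 0, ∃ κ > 0, ∀ a ∈ D, ∀ b ∈ D, η ≤ ‖a - b‖ →
      J a + J b + κ ≤ 2 * J (midpoint ℝ a b))
    (T : E →L[ℝ] F) {C : Set F} (hC : Convex ℝ C) (hCc : IsClosed C) {c : ℝ}
    (h : ∀ δ > 0, ∃ a ∈ nearFeasible D T C δ, c - δ ≤ J a) :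
    ∃ a ∈ D, T a ∈ C ∧ c ≤ J a := by
  let r : ℕ → ℝ := fun n => 1 / ((n : ℝ) + 1)
  have hr : ∀ n, 0 < r n := fun n => Nat.one_div_pos_of_nat
  have hra : Antitone r := fun m n hmn => Nat.one_div_le_one_div hmn
  have hr0 : Tendsto r atTop (𝓝 0) := tendsto_one_div_add_atTop_nhds_zero_nat
  let v : ℕ → ℝ := fun n => sSup (J '' nearFeasible D T C (r n))
  have hb : ∀ n, BddAbove (J '' nearFeasible D T C (r n)) := fun n =>
    hbdd.mono (Set.image_mono fun a ha => ha.1)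
  have hne : ∀ n, (J '' nearFeasible D T C (r n)).Nonempty := fun n => by
    obtain ⟨a, ha, -⟩ := h (r n) (hr n)
    exact ⟨_, a, ha, rfl⟩
  have hva : Antitone v := fun m n hmn =>
    csSup_le_csSup (hb m) (hne n) (Set.image_mono (nearFeasible_mono (hra hmn)))
  have hvc : ∀ n, c ≤ v n := fun n => by
    refine le_of_forall_pos_le_add fun e he => ?_
    obtain ⟨a, ha, hac⟩ := h (min e (r n)) (lt_min he (hr n))
    have h1 : J a ≤ v n :=
      le_csSup (hb n) ⟨a, nearFeasible_mono (min_le_right _ _) ha, rfl⟩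
    have := min_le_left e (r n)
    linarith
  have hvb : BddBelow (Set.range v) := ⟨c, by rintro _ ⟨n, rfl⟩; exact hvc n⟩
  have hvt := tendsto_atTop_ciInf hva hvb
  set V := ⨅ n, v n with hV
  have hVle : ∀ n, V ≤ v n := fun n => ciInf_le hvb n
  have hcV : c ≤ V := le_ciInf hvc
  have hex : ∀ n, ∃ a ∈ nearFeasible D T C (r n), v n - r n < J a := fun n => by
    obtain ⟨_, ⟨a, ha, rfl⟩, hlt⟩ := exists_lt_of_lt_csSup (hne n) (sub_lt_self (v n) (hr n))
    exact ⟨a, ha, hlt⟩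
  choose a ha hva' using hex
  -- The midpoint of two late terms is again `r N`-nearly feasible, so its value is at most `v N`.
  -- If the terms were `η` apart, the gain `κ` would push it above.
  have hcau : CauchySeq a := by
    rw [Metric.cauchySeq_iff]
    intro η hη
    obtain ⟨κ, hκ, hκ'⟩ := huc η hη
    have h1 : ∀ᶠ n in atTop, v n < V + κ / 4 := hvt.eventually_lt_const (by linarith)
    have h2 : ∀ᶠ n in atTop, r n < κ / 4 := hr0.eventually_lt_const (by linarith)
    obtain ⟨N, hN1, hN2⟩ := (h1.and h2).exists
    refine ⟨N, fun m hm n hn => ?_⟩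
    by_contra! hcon
    rw [dist_eq_norm] at hcon
    have h3 := hκ' _ (ha m).1 _ (ha n).1 hcon
    have h4 : J (midpoint ℝ (a m) (a n)) ≤ v N :=
      le_csSup (hb N) ⟨_, midpoint_mem_nearFeasible hD hC (nearFeasible_mono (hra hm) (ha m))
        (nearFeasible_mono (hra hn) (ha n)), rfl⟩
    linarith [hVle m, hVle n, hva' m, hva' n, hra hm, hra hn]
  obtain ⟨x, hx⟩ := cauchySeq_tendsto_of_complete hcau
  have hlev : ∀ e > 0, x ∈ D ∧ c - e ≤ J x := fun e he => by
    refine (hcl (c - e)).mem_of_tendsto hx ?_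
    filter_upwards [hr0.eventually_lt_const he] with n hn
    exact ⟨(ha n).1, by linarith [hva' n, hvc n]⟩
  refine ⟨x, (hlev 1 one_pos).1, ?_, le_of_forall_pos_le_add fun e he => by
    linarith [(hlev e he).2]⟩
  choose y hy hay using fun n => (ha n).2
  have hTx : Tendsto (fun n => T (a n)) atTop (𝓝 (T x)) := (T.continuous.tendsto x).comp hx
  have hd : Tendsto (fun n => T (a n) - y n) atTop (𝓝 0) :=
    squeeze_zero_norm (fun n => (hay n).le) hr0
  refine hCc.mem_of_tendsto (f := y) (b := atTop) ?_ (Eventually.of_forall hy)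
  simpa using hTx.sub hd

/-- A Lagrange multiplier theorem without constraint qualification: if no feasible point reaches
the level `c`, then some affine penalty keeps the penalized function below `c` on all of `D`. -/
theorem exists_multiplier [CompleteSpace E] {D : Set E} {J : E → ℝ}
    (hJ : ConcaveOn ℝ D J) (hDn : D.Nonempty) (hbdd : BddAbove (J '' D))
    (hcl : ∀ r, IsClosed {a | a ∈ D ∧ r ≤ J a})
    (huc : ∀ η > 0, ∃ κ > 0, ∀ a ∈ D, ∀ b ∈ D, η ≤ ‖a - b‖ →
      J a + J b + κ ≤ 2 * J (midpoint ℝ a b))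
    (T : E →L[ℝ] F) {C : Set F} (hC : Convex ℝ C) (hCc : IsClosed C) (hCn : C.Nonempty) {c : ℝ}
    (h : ∀ a ∈ D, T a ∈ C → J a < c) :
    ∃ (φ : F →L[ℝ] ℝ) (b : ℝ), (∀ y ∈ C, φ y ≤ b) ∧ ∀ a ∈ D, J a - φ (T a) + b ≤ c := by
  -- This margin does the work of a constraint qualification: it makes the open set `B` below
  -- disjoint from the hypograph `A`.
  obtain ⟨δ, hδ, hδ'⟩ : ∃ δ > 0, ∀ a ∈ nearFeasible D T C δ, J a < c - δ := by
    by_contra! hcon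
    obtain ⟨a, haD, haC, hac⟩ := exists_feasible_of_nearFeasible hJ.1 hbdd hcl huc T hC hCc hcon
    exact absurd (h a haD haC) hac.not_gt
  let A : Set (F × ℝ) := {p | ∃ a ∈ D, T a = p.1 ∧ p.2 ≤ J a}
  have hA : Convex ℝ A := by
    rintro ⟨_, r⟩ ⟨a, ha, rfl, hra⟩ ⟨_, s⟩ ⟨b, hb, rfl, hsb⟩ u w hu hw huw
    refine ⟨u • a + w • b, hJ.1 ha hb hu hw huw, by simp, ?_⟩
    refine le_trans ?_ (hJ.2 ha hb hu hw huw)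
    simp only [Prod.smul_mk, Prod.mk_add_mk, smul_eq_mul] at *
    gcongr
  let B : Set (F × ℝ) := Metric.thickening δ C ×ˢ Metric.ball c δ
  have hB : Convex ℝ B := (hC.thickening δ).prod (convex_ball c δ)
  have hBo : IsOpen B := Metric.isOpen_thickening.prod Metric.isOpen_ball
  have hdisj : Disjoint B A := by
    rw [Set.disjoint_left]
    rintro ⟨z, r⟩ ⟨hz, hr⟩ ⟨a, ha, haz, hra⟩
    obtain ⟨y, hy, hzy⟩ := Metric.mem_thickening_iff.1 hz
    have h1 := hδ' a ⟨ha, y, hy, by rw [haz, ← dist_eq_norm]; exact hzy⟩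
    have h2 := (abs_lt.1 (Real.dist_eq r c ▸ Metric.mem_ball.1 hr)).1
    simp only at hra
    linarith
  obtain ⟨Φ, u, hΦB, hΦA⟩ := geometric_hahn_banach_open hB hBo hA hdisj
  let φ : F →L[ℝ] ℝ := Φ.comp (ContinuousLinearMap.inl ℝ F ℝ)
  let s : ℝ := Φ (0, 1)
  have hΦ : ∀ y r, Φ (y, r) = φ y + r * s := fun y r => by
    have : ((y, r) : F × ℝ) = (y, 0) + r • (0, 1) := by simp
    rw [this, map_add, map_smul]
    rfl
  have hCB : ∀ y ∈ C, φ y + c * s < u := fun y hy => by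
    rw [← hΦ]
    exact hΦB _ ⟨Metric.self_subset_thickening hδ C hy, Metric.mem_ball_self hδ⟩
  have hDA : ∀ a ∈ D, ∀ r ≤ J a, u ≤ φ (T a) + r * s := fun a ha r hr => by
    rw [← hΦ]
    exact hΦA _ ⟨a, ha, rfl, hr⟩
  obtain ⟨a₀, ha₀⟩ := hDn
  -- The hypograph is unbounded downwards; a positive `s` would violate separation far below.
  have hs : s ≤ 0 := by
    by_contra! hs
    have h1 := hDA a₀ ha₀ (min (J a₀) ((u - 1 - φ (T a₀)) / s)) (min_le_left _ _)
    have h2 := mul_le_mul_of_nonneg_right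
      (min_le_right (J a₀) ((u - 1 - φ (T a₀)) / s)) hs.le
    rw [div_mul_cancel₀ _ hs.ne'] at h2
    linarith
  rcases hs.lt_or_eq with hs | hs
  -- Non-vertical hyperplane: dividing by `-s` gives `J` coefficient one.
  · have hs' : 0 < -s := by linarith
    have hss : (-s)⁻¹ * s = -1 := by rw [inv_neg, neg_mul, inv_mul_cancel₀ hs.ne]
    refine ⟨(-s)⁻¹ • φ, (-s)⁻¹ * u + c, fun y hy => ?_, fun a ha => ?_⟩
    · have h1 := mul_lt_mul_of_pos_left (hCB y hy) (inv_pos.2 hs')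
      have h2 : (-s)⁻¹ * (φ y + c * s) = (-s)⁻¹ * φ y - c := by linear_combination c * hss
      simp only [smul_apply, smul_eq_mul]
      linarith
    · have h1 := mul_le_mul_of_nonneg_left (hDA a ha _ le_rfl) (inv_pos.2 hs').le
      have h2 : (-s)⁻¹ * (φ (T a) + J a * s) = (-s)⁻¹ * φ (T a) - J a := by linear_combination J a * hss
      simp only [smul_apply, smul_eq_mul]
      linarith
  -- Vertical hyperplane: the separation says nothing about `J`. But the thickening of `C` leaves a
  -- gap `φ e > 0` between `C` and `T '' D`, and as `J ≤ K`, a large multiple of `φ` makes this gap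
  -- outweigh `K - c`.
  · simp only [hs, mul_zero, add_zero] at hCB hDA
    obtain ⟨y₀, hy₀⟩ := hCn
    obtain ⟨e, he, heδ⟩ : ∃ e, 0 < φ e ∧ ‖e‖ < δ := by
      let w := T a₀ - y₀
      have hw : 0 < φ w := by
        simp only [w, map_sub]; linarith [hCB y₀ hy₀, hDA a₀ ha₀ _ le_rfl]
      have hw1 : 0 < ‖w‖ + 1 := by positivity
      refine ⟨(δ / (‖w‖ + 1)) • w, by simp only [map_smul, smul_eq_mul]; positivity, ?_⟩
      rw [norm_smul, Real.norm_of_nonneg (by positivity), div_mul_eq_mul_div,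
        div_lt_iff₀ hw1]
      nlinarith
    have hgap : ∀ y ∈ C, φ y ≤ u - φ e := fun y hy => by
      have h1 := hΦB (y + e, c) ⟨Metric.mem_thickening_iff.2 ⟨y, hy, by simpa using heδ⟩,
        Metric.mem_ball_self hδ⟩
      rw [hΦ, hs, map_add] at h1
      linarith
    obtain ⟨K, hK⟩ := hbdd
    let t := max 0 ((K - c) / φ e)
    have ht : K - c ≤ t * φ e := (div_le_iff₀ he).1 (le_max_right _ _)
    have ht0 : 0 ≤ t := le_max_left _ _
    refine ⟨t • φ, t * (u - φ e), fun y hy => ?_, fun a ha => ?_⟩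
    · exact mul_le_mul_of_nonneg_left (hgap y hy) ht0
    · have h1 : J a ≤ K := hK ⟨a, ha, rfl⟩
      have h2 := mul_le_mul_of_nonneg_left (hDA a ha _ le_rfl) ht0
      simp only [smul_apply, smul_eq_mul]
      linarith

end Abstract

/-! ### Uniform convexity of the entropy integrand. -/

open InformationTheory

/-- A quantitative form of the midpoint convexity of `x log x`. -/
theorem half_sq_sqrt_sub_sqrt_le {a b : ℝ} (ha : 0 ≤ a) (hb : 0 ≤ b) :
    (√a - √b) ^ 2 / 2 ≤ klFun a + klFun b - 2 * klFun ((a + b) / 2) := by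
  -- This is `log y ≤ y - 1` at `y = √(m / x)`, multiplied by `2 * x`. It is used at `x = a` and `x
  -- = b` with `m` their mean, where the linear terms of `klFun` cancel.
  have key : ∀ {x m : ℝ}, 0 ≤ x → 0 < m →
      2 * x - 2 * √x * √m ≤ x * Real.log x - x * Real.log m := by
    intro x m hx hm
    rcases hx.eq_or_lt with rfl | hx
    · simp
    have hq : 0 < √(m / x) := Real.sqrt_pos.2 (by positivity)
    have h1 := Real.log_le_sub_one_of_pos hq
    rw [Real.log_sqrt (by positivity), Real.log_div hm.ne' hx.ne'] at h1
    have h2 : x * √(m / x) = √x * √m := by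
      rw [Real.sqrt_div hm.le]
      nth_rewrite 1 [← Real.mul_self_sqrt hx.le]
      field_simp
    nlinarith [mul_le_mul_of_nonneg_left h1 hx.le]
  rcases (add_nonneg ha hb).eq_or_lt with h0 | h0
  · have ha0 : a = 0 := by linarith
    have hb0 : b = 0 := by linarith
    simp [ha0, hb0, klFun_zero]
    norm_num
  have hm : 0 < (a + b) / 2 := by linarith
  have h1 := key ha hm
  have h2 := key hb hm
  simp only [klFun_apply]
  set u := √a
  set v := √b
  have hu : u ^ 2 = a := Real.sq_sqrt ha
  have hv : v ^ 2 = b := Real.sq_sqrt hb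
  set w := √((a + b) / 2)
  have hw : w ^ 2 = (a + b) / 2 := Real.sq_sqrt hm.le
  have hw0 : 0 ≤ w := Real.sqrt_nonneg _
  have hu0 : 0 ≤ u := Real.sqrt_nonneg _
  have hv0 : 0 ≤ v := Real.sqrt_nonneg _
  have h3 : (u - v) ^ 2 / 2 ≤ 2 * a + 2 * b - 2 * u * w - 2 * v * w := by
    nlinarith [sq_nonneg (2 * w - (u + v))]
  linarith

/-- Factor `|a - b| = |√a - √b| * (√a + √b)` and apply Young's inequality with weight `t`. The bound
is linear in `|a - b|`, so it integrates directly to an `L¹` estimate, and `t` is chosen afterwards.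
-/
theorem mul_abs_sub_le_klFun_gap {a b : ℝ} (ha : 0 ≤ a) (hb : 0 ≤ b) (t : ℝ) :
    t * |a - b| ≤ klFun a + klFun b - 2 * klFun ((a + b) / 2) + t ^ 2 * (a + b) := by
  have h := half_sq_sqrt_sub_sqrt_le ha hb
  have hu : √a ^ 2 = a := Real.sq_sqrt ha
  have hv : √b ^ 2 = b := Real.sq_sqrt hb
  have hab : |a - b| = |√a - √b| * (√a + √b) := by
    rw [← abs_of_nonneg (add_nonneg (Real.sqrt_nonneg a) (Real.sqrt_nonneg b)), ← abs_mul]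
    congr 1
    nlinarith
  rw [hab]
  nlinarith [sq_nonneg (|√a - √b| - t * (√a + √b)), sq_abs (√a - √b),
    mul_nonneg (sq_nonneg t) (sq_nonneg (√a - √b))]

/-! ### The penalized mean on densities in `L¹`. -/

variable {Ω : Type*} [MeasurableSpace Ω] {μ : Measure Ω}
  {F : Type*} [NormedAddCommGroup F] [NormedSpace ℝ F]

theorem integrable_coe_smul {g : Ω → F} (hg : AEStronglyMeasurable g μ) {B : ℝ}
    (hB : ∀ x, ‖g x‖ ≤ B) (ρ : Ω →₁[μ] ℝ) : Integrable (fun x => ρ x • g x) μ :=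
  (L1.integrable_coeFn ρ).smul_bdd B hg (Eventually.of_forall hB)

/-- Integration of a bounded function `g` against an `L¹` density, as a continuous linear map. -/
noncomputable def weightedIntegral (g : Ω → F) (hg : AEStronglyMeasurable g μ) (B : ℝ)
    (hB : ∀ x, ‖g x‖ ≤ B) : (Ω →₁[μ] ℝ) →L[ℝ] F :=
  LinearMap.mkContinuous
    { toFun := fun ρ => ∫ x, ρ x • g x ∂μ
      map_add' := fun ρ σ => by
        rw [← integral_add (integrable_coe_smul hg hB ρ) (integrable_coe_smul hg hB σ)]
        refine integral_congr_ae ?_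
        filter_upwards [Lp.coeFn_add ρ σ] with x hx
        rw [hx, Pi.add_apply, add_smul]
      map_smul' := fun c ρ => by
        rw [RingHom.id_apply, ← integral_smul]
        refine integral_congr_ae ?_
        filter_upwards [Lp.coeFn_smul c ρ] with x hx
        rw [hx, Pi.smul_apply, smul_assoc] }
    B fun ρ => by
      rw [L1.norm_eq_integral_norm, ← integral_const_mul]
      refine norm_integral_le_of_norm_le ((L1.integrable_coeFn ρ).norm.const_mul B) ?_
      refine Eventually.of_forall fun x => ?_
      rw [norm_smul, mul_comm]
      exact mul_le_mul_of_nonneg_right (hB x) (norm_nonneg _)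

theorem weightedIntegral_apply (g : Ω → F) (hg : AEStronglyMeasurable g μ) (B : ℝ)
    (hB : ∀ x, ‖g x‖ ≤ B) (ρ : Ω →₁[μ] ℝ) :
    weightedIntegral g hg B hB ρ = ∫ x, ρ x • g x ∂μ := rfl

variable (μ) in
/-- The probability densities with finite entropy with respect to `μ`. -/
def entropyDensities : Set (Ω →₁[μ] ℝ) :=
  {ρ | 0 ≤ᵐ[μ] ρ ∧ ∫ x, ρ x ∂μ = 1 ∧ Integrable (fun x => klFun (ρ x)) μ}

/-- The expectation of `f` under the density `ρ`, penalized by `ε` times the entropy of `ρ`. -/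
noncomputable def penalizedMean (f : Ω → ℝ) (ε : ℝ) (ρ : Ω →₁[μ] ℝ) : ℝ :=
  ∫ x, ρ x • f x ∂μ - ε * ∫ x, klFun (ρ x) ∂μ

theorem aestronglyMeasurable_klFun_comp (ρ : Ω →₁[μ] ℝ) :
    AEStronglyMeasurable (fun x => klFun (ρ x)) μ :=
  continuous_klFun.comp_aestronglyMeasurable (Lp.aestronglyMeasurable ρ)

theorem klFun_combo_ae {ρ σ : Ω →₁[μ] ℝ} (hρ : 0 ≤ᵐ[μ] ρ) (hσ : 0 ≤ᵐ[μ] σ)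
    {u w : ℝ} (hu : 0 ≤ u) (hw : 0 ≤ w) (huw : u + w = 1) :
    ∀ᵐ x ∂μ, 0 ≤ (u • ρ + w • σ : Ω →₁[μ] ℝ) x ∧
      klFun ((u • ρ + w • σ : Ω →₁[μ] ℝ) x) ≤ u * klFun (ρ x) + w * klFun (σ x) := by
  filter_upwards [hρ, hσ, Lp.coeFn_add (u • ρ) (w • σ), Lp.coeFn_smul u ρ, Lp.coeFn_smul w σ]
    with x h1 h2 h3 h4 h5
  simp only [Pi.zero_apply] at h1 h2
  rw [h3, Pi.add_apply, h4, h5]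
  simp only [Pi.smul_apply, smul_eq_mul]
  exact ⟨by positivity, convexOn_klFun.2 h1 h2 hu hw huw⟩

theorem convex_entropyDensities : Convex ℝ (entropyDensities μ) := by
  intro ρ hρ σ hσ u w hu hw huw
  have h := klFun_combo_ae hρ.1 hσ.1 hu hw huw
  refine ⟨h.mono fun x hx => hx.1, ?_, ?_⟩
  · have h1 : ∀ τ : Ω →₁[μ] ℝ, ∫ x, τ x ∂μ = L1.integral τ := fun τ =>
      (L1.integral_eq_integral τ).symm
    have hρ1 := hρ.2.1
    have hσ1 := hσ.2.1
    rw [h1] at hρ1 hσ1 ⊢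
    rw [L1.integral_add, L1.integral_smul, L1.integral_smul, hρ1, hσ1]
    simpa using huw
  · refine Integrable.mono' ((hρ.2.2.const_mul u).add (hσ.2.2.const_mul w))
      (aestronglyMeasurable_klFun_comp _) ?_
    filter_upwards [h] with x hx
    rw [Real.norm_of_nonneg (klFun_nonneg hx.1)]
    exact hx.2

theorem integral_klFun_combo_le {ρ σ : Ω →₁[μ] ℝ} (hρ : ρ ∈ entropyDensities μ)
    (hσ : σ ∈ entropyDensities μ) {u w : ℝ} (hu : 0 ≤ u) (hw : 0 ≤ w) (huw : u + w = 1) :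
    ∫ x, klFun ((u • ρ + w • σ : Ω →₁[μ] ℝ) x) ∂μ ≤
      u * ∫ x, klFun (ρ x) ∂μ + w * ∫ x, klFun (σ x) ∂μ := by
  rw [← integral_const_mul, ← integral_const_mul,
    ← integral_add (hρ.2.2.const_mul u) (hσ.2.2.const_mul w)]
  exact integral_mono_ae (convex_entropyDensities hρ hσ hu hw huw).2.2
    ((hρ.2.2.const_mul u).add (hσ.2.2.const_mul w))
    ((klFun_combo_ae hρ.1 hσ.1 hu hw huw).mono fun x hx => hx.2)

theorem concaveOn_penalizedMean {f : Ω → ℝ} (hf : AEStronglyMeasurable f μ) {B : ℝ}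
    (hB : ∀ x, ‖f x‖ ≤ B) {ε : ℝ} (hε : 0 ≤ ε) :
    ConcaveOn ℝ (entropyDensities μ) (penalizedMean (μ := μ) f ε) := by
  refine ⟨convex_entropyDensities, fun ρ hρ σ hσ u w hu hw huw => ?_⟩
  have h := mul_le_mul_of_nonneg_left (integral_klFun_combo_le hρ hσ hu hw huw) hε
  simp only [penalizedMean, ← weightedIntegral_apply f hf B hB, map_add, map_smul]
  simp only [smul_eq_mul]
  linarith

theorem penalizedMean_le {f : Ω → ℝ} (hf : AEStronglyMeasurable f μ) {B : ℝ}
    (hB : ∀ x, ‖f x‖ ≤ B) {ε : ℝ} (hε : 0 ≤ ε) {ρ : Ω →₁[μ] ℝ} (hρ : ρ ∈ entropyDensities μ) :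
    penalizedMean f ε ρ ≤ B := by
  have h1 : ∫ x, ρ x • f x ∂μ ≤ ∫ x, ρ x * B ∂μ := by
    refine integral_mono_ae (integrable_coe_smul hf hB ρ)
      ((L1.integrable_coeFn ρ).mul_const B) ?_
    filter_upwards [hρ.1] with x hx
    exact mul_le_mul_of_nonneg_left ((le_abs_self _).trans (hB x)) hx
  rw [integral_mul_const, hρ.2.1, one_mul] at h1
  have h2 : 0 ≤ ∫ x, klFun (ρ x) ∂μ :=
    integral_nonneg_of_ae (hρ.1.mono fun x hx => klFun_nonneg hx)
  have := mul_nonneg hε h2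
  rw [penalizedMean]
  linarith

/-- The expectation is linear, so only the entropy contributes. Integrating
`mul_abs_sub_le_klFun_gap` with `t = η / 4` over densities of total mass 2 leaves `η ^ 2 / 4 - η ^ 2
/ 8`. -/
theorem penalizedMean_midpoint {f : Ω → ℝ} (hf : AEStronglyMeasurable f μ) {B : ℝ}
    (hB : ∀ x, ‖f x‖ ≤ B) {ε : ℝ} (hε : 0 < ε) {η : ℝ} (hη : 0 < η) {ρ σ : Ω →₁[μ] ℝ}
    (hρ : ρ ∈ entropyDensities μ) (hσ : σ ∈ entropyDensities μ) (h : η ≤ ‖ρ - σ‖) :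
    penalizedMean f ε ρ + penalizedMean f ε σ + ε * (η ^ 2 / 8) ≤
      2 * penalizedMean f ε (midpoint ℝ ρ σ) := by
  set m := midpoint ℝ ρ σ with hm
  have hm' : m = (2⁻¹ : ℝ) • (ρ + σ) := by rw [hm, midpoint_eq_smul_add, invOf_eq_inv]
  have hmD : m ∈ entropyDensities μ := convex_entropyDensities.midpoint_mem hρ hσ
  have hmx : ∀ᵐ x ∂μ, m x = (ρ x + σ x) / 2 := by
    rw [hm']
    filter_upwards [Lp.coeFn_smul (2⁻¹ : ℝ) (ρ + σ), Lp.coeFn_add ρ σ] with x h1 h2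
    rw [h1, Pi.smul_apply, h2, Pi.add_apply, smul_eq_mul]
    ring
  have hρi := L1.integrable_coeFn ρ
  have hσi := L1.integrable_coeFn σ
  have hgap : η / 4 * ‖ρ - σ‖ ≤ ∫ x, klFun (ρ x) ∂μ + ∫ x, klFun (σ x) ∂μ
      - 2 * ∫ x, klFun (m x) ∂μ + (η / 4) ^ 2 * (∫ x, ρ x ∂μ + ∫ x, σ x ∂μ) := by
    have hsum : Integrable (fun x => klFun (ρ x) + klFun (σ x)) μ := hρ.2.2.add hσ.2.2
    have hdiff : Integrable (fun x => klFun (ρ x) + klFun (σ x) - 2 * klFun (m x)) μ :=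
      hsum.sub (hmD.2.2.const_mul 2)
    have hmass : Integrable (fun x => (η / 4) ^ 2 * (ρ x + σ x)) μ := (hρi.add hσi).const_mul _
    rw [L1.norm_eq_integral_norm, ← integral_const_mul, ← integral_add hρi hσi,
      ← integral_const_mul, ← integral_const_mul, ← integral_add hρ.2.2 hσ.2.2,
      ← integral_sub hsum (hmD.2.2.const_mul 2), ← integral_add hdiff hmass]
    refine integral_mono_ae ((L1.integrable_coeFn (ρ - σ)).norm.const_mul _)
      (hdiff.add hmass) ?_
    filter_upwards [hρ.1, hσ.1, hmx, Lp.coeFn_sub ρ σ] with x h1 h2 h3 h4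
    rw [h3, h4, Pi.sub_apply, Real.norm_eq_abs]
    exact mul_abs_sub_le_klFun_gap h1 h2 _
  rw [hρ.2.1, hσ.2.1] at hgap
  have hgap' : η ^ 2 / 8 ≤ ∫ x, klFun (ρ x) ∂μ + ∫ x, klFun (σ x) ∂μ
      - 2 * ∫ x, klFun (m x) ∂μ := by nlinarith
  have h3 := mul_le_mul_of_nonneg_left hgap' hε.le
  have h4 : weightedIntegral f hf B hB m =
      2⁻¹ * (weightedIntegral f hf B hB ρ + weightedIntegral f hf B hB σ) := by
    rw [hm', map_smul, map_add, smul_eq_mul]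
  simp only [penalizedMean, ← weightedIntegral_apply f hf B hB, h4]
  linarith

/-- The entropy is lower semicontinuous by Fatou, applied to `klFun ≥ 0` along an a.e. convergent
subsequence. The level `r` bounds the entropies, so the limit has finite entropy too. -/
theorem isClosed_superlevel_penalizedMean {f : Ω → ℝ} (hf : AEStronglyMeasurable f μ)
    {B : ℝ} (hB : ∀ x, ‖f x‖ ≤ B) {ε : ℝ} (hε : 0 < ε) (r : ℝ) :
    IsClosed {ρ : Ω →₁[μ] ℝ | ρ ∈ entropyDensities μ ∧ r ≤ penalizedMean f ε ρ} := by
  refine IsSeqClosed.isClosed fun a ρ ha hρ => ?_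
  obtain ⟨ns, hns, hae⟩ := (tendstoInMeasure_of_tendsto_Lp hρ).exists_seq_tendsto_ae
  have hρ' := hρ.comp hns.tendsto_atTop
  have hnn : ∀ᵐ x ∂μ, ∀ n, 0 ≤ a (ns n) x := ae_all_iff.2 fun n => (ha (ns n)).1.1
  have h0 : 0 ≤ᵐ[μ] ρ := by
    filter_upwards [hae, hnn] with x hx hx'
    exact ge_of_tendsto' hx hx'
  have hint : ∫ x, ρ x ∂μ = 1 := by
    have h1 : ∀ τ : Ω →₁[μ] ℝ, ∫ x, τ x ∂μ = L1.integral τ := fun τ =>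
      (L1.integral_eq_integral τ).symm
    rw [h1]
    have h2 := (L1.continuous_integral.tendsto ρ).comp hρ
    refine tendsto_nhds_unique h2 (tendsto_const_nhds.congr fun n => ?_)
    rw [Function.comp_apply, ← h1, (ha n).1.2.1]
  set b : ℕ → ℝ := fun n => (weightedIntegral f hf B hB (a (ns n)) - r) / ε
  set b' : ℝ := (weightedIntegral f hf B hB ρ - r) / ε with hb'
  have hb : Tendsto b atTop (𝓝 b') :=
    ((((weightedIntegral f hf B hB).continuous.tendsto ρ).comp hρ').sub_const r).div_const ε
  have hnn' : ∀ n, 0 ≤ᵐ[μ] fun x => klFun (a (ns n) x) := fun n =>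
    (ha (ns n)).1.1.mono fun x hx => klFun_nonneg hx
  have hab : ∀ n, ∫ x, klFun (a (ns n) x) ∂μ ≤ b n := fun n => by
    have := (ha (ns n)).2
    rw [penalizedMean, ← weightedIntegral_apply f hf B hB] at this
    rw [le_div_iff₀ hε]
    linarith
  have hb0 : 0 ≤ b' := ge_of_tendsto' hb fun n => (integral_nonneg_of_ae (hnn' n)).trans (hab n)
  have hnnρ : 0 ≤ᵐ[μ] fun x => klFun (ρ x) := h0.mono fun x hx => klFun_nonneg hx
  have hfatou : ∫⁻ x, ENNReal.ofReal (klFun (ρ x)) ∂μ ≤ ENNReal.ofReal b' := by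
    calc ∫⁻ x, ENNReal.ofReal (klFun (ρ x)) ∂μ
        = ∫⁻ x, liminf (fun n => ENNReal.ofReal (klFun (a (ns n) x))) atTop ∂μ := by
          refine lintegral_congr_ae ?_
          filter_upwards [hae] with x hx
          exact (((ENNReal.continuous_ofReal.comp continuous_klFun).tendsto _).comp
            hx).liminf_eq.symm
      _ ≤ liminf (fun n => ∫⁻ x, ENNReal.ofReal (klFun (a (ns n) x)) ∂μ) atTop :=
          lintegral_liminf_le' fun n =>
            (aestronglyMeasurable_klFun_comp (a (ns n))).aemeasurable.ennreal_ofReal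
      _ ≤ liminf (fun n => ENNReal.ofReal (b n)) atTop := by
          refine liminf_le_liminf (Eventually.of_forall fun n => ?_)
          rw [← ofReal_integral_eq_lintegral_ofReal (ha (ns n)).1.2.2 (hnn' n)]
          exact ENNReal.ofReal_le_ofReal (hab n)
      _ = ENNReal.ofReal b' := ((ENNReal.continuous_ofReal.tendsto b').comp hb).liminf_eq
  have hi : Integrable (fun x => klFun (ρ x)) μ :=
    (lintegral_ofReal_ne_top_iff_integrable (aestronglyMeasurable_klFun_comp ρ) hnnρ).1
      (hfatou.trans_lt ENNReal.ofReal_lt_top).ne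
  refine ⟨⟨h0, hint, hi⟩, ?_⟩
  rw [← ofReal_integral_eq_lintegral_ofReal hi hnnρ, ENNReal.ofReal_le_ofReal_iff hb0, hb',
    le_div_iff₀ hε] at hfatou
  rw [penalizedMean, ← weightedIntegral_apply f hf B hB]
  linarith

theorem one_mem_entropyDensities [IsProbabilityMeasure μ] :
    (integrable_const (1 : ℝ)).toL1 (fun _ : Ω => (1 : ℝ)) ∈ entropyDensities μ := by
  have h := (integrable_const (μ := μ) (1 : ℝ)).coeFn_toL1
  refine ⟨h.mono fun x hx => by rw [hx]; exact zero_le_one, ?_, ?_⟩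
  · rw [integral_congr_ae h]; simp
  · refine (integrable_zero Ω ℝ μ).congr (h.mono fun x hx => ?_)
    simp only [Pi.zero_apply]
    rw [hx, klFun_one]

/-- Lagrange multipliers for entropy-penalized expectations under moment constraints. -/
theorem exists_multiplier_penalizedMean [IsProbabilityMeasure μ] {f : Ω → ℝ}
    (hf : AEStronglyMeasurable f μ) {B : ℝ} (hB : ∀ x, ‖f x‖ ≤ B) {ε : ℝ} (hε : 0 < ε)
    {g : Ω → F} (hg : AEStronglyMeasurable g μ) {B' : ℝ} (hB' : ∀ x, ‖g x‖ ≤ B')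
    {C : Set F} (hC : Convex ℝ C) (hCc : IsClosed C) (hCn : C.Nonempty) {c : ℝ}
    (h : ∀ ρ ∈ entropyDensities μ, ∫ x, ρ x • g x ∂μ ∈ C → penalizedMean f ε ρ < c) :
    ∃ (φ : F →L[ℝ] ℝ) (b : ℝ), (∀ y ∈ C, φ y ≤ b) ∧ ∀ ρ ∈ entropyDensities μ,
      penalizedMean f ε ρ - φ (∫ x, ρ x • g x ∂μ) + b ≤ c :=
  exists_multiplier (concaveOn_penalizedMean hf hB hε.le) ⟨_, one_mem_entropyDensities⟩
    ⟨B, by rintro _ ⟨ρ, hρ, rfl⟩; exact penalizedMean_le hf hB hε.le hρ⟩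
    (isClosed_superlevel_penalizedMean hf hB hε)
    (fun η hη => ⟨ε * (η ^ 2 / 8), by positivity, fun ρ hρ σ hσ hρσ =>
      penalizedMean_midpoint hf hB hε hη hρ hσ hρσ⟩)
    (weightedIntegral g hg B' hB') hC hCc hCn h

/-! ### The Gibbs variational principle. -/

/-- Young's inequality for `klFun` and its conjugate `exp - 1`. -/
theorem mul_sub_klFun_le {x : ℝ} (hx : 0 ≤ x) (y : ℝ) : x * y - klFun x ≤ Real.exp y - 1 := by
  rw [klFun_apply]
  rcases hx.eq_or_lt with rfl | hx
  · simp [(Real.exp_pos y).le]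
  have h1 := mul_le_mul_of_nonneg_left (Real.add_one_le_exp (y - Real.log x)) hx.le
  have h2 : x * Real.exp (y - Real.log x) = Real.exp y := by
    rw [Real.exp_sub, Real.exp_log hx, mul_div_cancel₀ _ hx.ne']
  linarith

theorem integrable_exp_of_bound [IsFiniteMeasure μ] {h : Ω → ℝ} (hh : AEStronglyMeasurable h μ)
    {B : ℝ} (hB : ∀ x, ‖h x‖ ≤ B) : Integrable (fun x => Real.exp (h x)) μ :=
  Integrable.of_bound (Real.continuous_exp.comp_aestronglyMeasurable hh) (Real.exp B)
    (Eventually.of_forall fun x => by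
      rw [Real.norm_of_nonneg (Real.exp_pos _).le, Real.exp_le_exp]
      exact (le_abs_self _).trans (hB x))

/-- The Gibbs variational inequality. -/
theorem integral_sub_entropy_le_log_integral_exp [IsProbabilityMeasure μ] {h : Ω → ℝ}
    (hh : AEStronglyMeasurable h μ) {B : ℝ} (hB : ∀ x, ‖h x‖ ≤ B) {ρ : Ω →₁[μ] ℝ}
    (hρ : ρ ∈ entropyDensities μ) :
    ∫ x, ρ x • h x ∂μ - ∫ x, klFun (ρ x) ∂μ ≤ Real.log (∫ x, Real.exp (h x) ∂μ) := by
  have hi := integrable_exp_of_bound hh hB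
  set Z := ∫ x, Real.exp (h x) ∂μ with hZ
  have hZ0 : 0 < Z := integral_exp_pos hi
  have hρi := L1.integrable_coeFn ρ
  have hρh := integrable_coe_smul hh hB ρ
  have hlin : Integrable (fun x => ρ x • h x - ρ x * Real.log Z) μ := hρh.sub (hρi.mul_const _)
  have h1 : ∫ x, (ρ x • h x - ρ x * Real.log Z - klFun (ρ x)) ∂μ ≤
      ∫ x, (Real.exp (h x) * Z⁻¹ - 1) ∂μ := by
    refine integral_mono_ae (hlin.sub hρ.2.2)
      ((hi.mul_const _).sub (integrable_const _)) ?_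
    filter_upwards [hρ.1] with x hx
    -- The shift by `log Z` makes the integral of the right-hand side vanish.
    have := mul_sub_klFun_le hx (h x - Real.log Z)
    rw [Real.exp_sub, Real.exp_log hZ0, mul_sub, div_eq_mul_inv] at this
    exact this
  rw [integral_sub hlin hρ.2.2, integral_sub hρh (hρi.mul_const _),
    integral_sub (hi.mul_const _) (integrable_const _), integral_mul_const, integral_mul_const,
    hρ.2.1, ← hZ, mul_inv_cancel₀ hZ0.ne'] at h1
  simp only [integral_const, probReal_univ, smul_eq_mul, one_mul, mul_one] at h1 ⊢
  linarith

/-- The Gibbs density attains equality in the Gibbs variational inequality. -/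
theorem exists_integral_sub_entropy_eq_log_integral_exp [IsProbabilityMeasure μ] {h : Ω → ℝ}
    (hh : AEStronglyMeasurable h μ) {B : ℝ} (hB : ∀ x, ‖h x‖ ≤ B) :
    ∃ ρ ∈ entropyDensities μ,
      ∫ x, ρ x • h x ∂μ - ∫ x, klFun (ρ x) ∂μ = Real.log (∫ x, Real.exp (h x) ∂μ) := by
  have hi := integrable_exp_of_bound hh hB
  set Z := ∫ x, Real.exp (h x) ∂μ with hZ
  have hZ0 : 0 < Z := integral_exp_pos hi
  have hpi : Integrable (fun x => Real.exp (h x) * Z⁻¹) μ := hi.mul_const _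
  have hp := hpi.coeFn_toL1
  set ρ := hpi.toL1 (fun x => Real.exp (h x) * Z⁻¹)
  have hone : ∫ x, ρ x ∂μ = 1 := by
    rw [integral_congr_ae hp, integral_mul_const, ← hZ, mul_inv_cancel₀ hZ0.ne']
  have hρi := L1.integrable_coeFn ρ
  have hρh := integrable_coe_smul hh hB ρ
  have hkl : (fun x => klFun (ρ x)) =ᵐ[μ]
      fun x => ρ x • h x - ρ x * Real.log Z + 1 - ρ x := by
    filter_upwards [hp] with x hx
    rw [klFun_apply, hx, Real.log_mul (Real.exp_pos _).ne' (inv_pos.2 hZ0).ne', Real.log_exp,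
      Real.log_inv, smul_eq_mul]
    ring
  have hlin : Integrable (fun x => ρ x • h x - ρ x * Real.log Z) μ := hρh.sub (hρi.mul_const _)
  have hlin1 : Integrable (fun x => ρ x • h x - ρ x * Real.log Z + 1) μ :=
    hlin.add (integrable_const 1)
  refine ⟨ρ, ⟨?_, hone, (hlin1.sub hρi).congr hkl.symm⟩, ?_⟩
  · filter_upwards [hp] with x hx
    rw [hx]
    exact mul_nonneg (Real.exp_pos _).le (inv_pos.2 hZ0).le
  · rw [integral_congr_ae hkl,
      integral_sub hlin1 hρi,
      integral_add hlin (integrable_const 1),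
      integral_sub hρh (hρi.mul_const _), integral_mul_const, hone]
    simp

/-! ### Laws of finite entropy and their densities. -/

/-- The density of `Q` with respect to `μ` as an element of `L¹(μ)`. -/
noncomputable def densityOf (Q μ : Measure Ω) [IsFiniteMeasure Q] : Ω →₁[μ] ℝ :=
  (Measure.integrable_toReal_rnDeriv (μ := Q) (ν := μ)).toL1 _

theorem coeFn_densityOf (Q μ : Measure Ω) [IsFiniteMeasure Q] :
    densityOf Q μ =ᵐ[μ] fun x => (Q.rnDeriv μ x).toReal :=
  Integrable.coeFn_toL1 _

theorem integral_densityOf_smul {Q : Measure Ω} [IsFiniteMeasure Q] [SigmaFinite μ]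
    (hQ : Q ≪ μ) (g : Ω → F) : ∫ x, densityOf Q μ x • g x ∂μ = ∫ x, g x ∂Q := by
  rw [← integral_rnDeriv_smul hQ]
  refine integral_congr_ae ?_
  filter_upwards [coeFn_densityOf Q μ] with x hx
  rw [hx]

theorem integral_klFun_densityOf {Q : Measure Ω} [IsFiniteMeasure Q] [IsFiniteMeasure μ]
    (hQ : Q ≪ μ) : ∫ x, klFun (densityOf Q μ x) ∂μ = (klDiv Q μ).toReal := by
  rw [toReal_klDiv_eq_integral_klFun hQ]
  refine integral_congr_ae ?_
  filter_upwards [coeFn_densityOf Q μ] with x hx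
  rw [hx]

theorem densityOf_mem_entropyDensities {Q : Measure Ω} [IsProbabilityMeasure Q]
    [IsFiniteMeasure μ] (hQ : klDiv Q μ ≠ ⊤) : densityOf Q μ ∈ entropyDensities μ := by
  obtain ⟨hac, hint⟩ := klDiv_ne_top_iff.1 hQ
  have hd := coeFn_densityOf Q μ
  refine ⟨?_, ?_, ((integrable_klFun_rnDeriv_iff hac).2 hint).congr ?_⟩
  · filter_upwards [hd] with x hx
    rw [hx]
    exact ENNReal.toReal_nonneg
  · simpa using integral_densityOf_smul hac (fun _ => (1 : ℝ))
  · filter_upwards [hd] with x hx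
    rw [hx]

theorem exists_densityOf_eq [IsFiniteMeasure μ] {ρ : Ω →₁[μ] ℝ} (hρ : ρ ∈ entropyDensities μ) :
    ∃ (Q : Measure Ω) (_ : IsProbabilityMeasure Q), densityOf Q μ = ρ ∧ klDiv Q μ ≠ ⊤ := by
  have hm : Measurable fun x => ENNReal.ofReal (ρ x) :=
    (Lp.stronglyMeasurable ρ).measurable.ennreal_ofReal
  let Q := μ.withDensity fun x => ENNReal.ofReal (ρ x)
  have hQ : IsProbabilityMeasure Q := ⟨by
    rw [withDensity_apply _ MeasurableSet.univ, Measure.restrict_univ,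
      ← ofReal_integral_eq_lintegral_ofReal (L1.integrable_coeFn ρ) hρ.1, hρ.2.1,
      ENNReal.ofReal_one]⟩
  have hd : (fun x => (Q.rnDeriv μ x).toReal) =ᵐ[μ] ρ := by
    filter_upwards [Measure.rnDeriv_withDensity μ hm, hρ.1] with x hx hx'
    rw [hx, ENNReal.toReal_ofReal hx']
  have hac : Q ≪ μ := withDensity_absolutelyContinuous _ _
  refine ⟨Q, hQ, Lp.ext ((coeFn_densityOf Q μ).trans hd), klDiv_ne_top hac ?_⟩
  rw [← integrable_klFun_rnDeriv_iff hac]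
  refine hρ.2.2.congr ?_
  filter_upwards [hd] with x hx
  rw [hx]

end EntropicDuality

namespace MomentDRO

open InformationTheory EntropicDuality

/-! ### The Frobenius pairing and positive semi-definiteness. -/

variable {k : ℕ}

theorem frob_eq_dotProduct_hadamard (A B : Matrix (Fin k) (Fin k) ℝ) :
    frob A B = star (1 : Fin k → ℝ) ⬝ᵥ ((A.hadamard B).mulVec 1) := by
  simp [frob, dotProduct, Matrix.mulVec, Matrix.hadamard_apply]

/-- By the Schur product theorem the Hadamard product is positive semi-definite; the pairing is its
quadratic form at the all-ones vector. -/
theorem frob_nonneg {A B : Matrix (Fin k) (Fin k) ℝ} (hA : A.PosSemidef) (hB : B.PosSemidef) :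
    0 ≤ frob A B := by
  rw [frob_eq_dotProduct_hadamard]
  exact (hA.hadamard hB).dotProduct_mulVec_nonneg 1

theorem frob_sub_right (A B B' : Matrix (Fin k) (Fin k) ℝ) :
    frob A (B - B') = frob A B - frob A B' := by
  simp [frob, mul_sub, Finset.sum_sub_distrib]

theorem frob_smul_right (A B : Matrix (Fin k) (Fin k) ℝ) (c : ℝ) :
    frob A (c • B) = c * frob A B := by
  simp [frob, Finset.mul_sum, mul_left_comm]

/-- The matrix representing a functional need not be symmetric, but symmetric matrices see only its
symmetric part. -/
theorem frob_symm_part {A B : Matrix (Fin k) (Fin k) ℝ} (hB : B.IsHermitian) :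
    frob ((2⁻¹ : ℝ) • (A + A.transpose)) B = frob A B := by
  have h : frob A.transpose B = frob A B := by
    rw [frob, Finset.sum_comm]
    refine Finset.sum_congr rfl fun i _ => Finset.sum_congr rfl fun j _ => ?_
    rw [Matrix.transpose_apply, ← hB.apply i j, star_trivial]
  have h' : frob ((2⁻¹ : ℝ) • (A + A.transpose)) B = 2⁻¹ * (frob A B + frob A.transpose B) := by
    simp only [frob, Matrix.smul_apply, Matrix.add_apply, smul_eq_mul, ← Finset.sum_add_distrib,
      Finset.mul_sum]
    refine Finset.sum_congr rfl fun i _ => Finset.sum_congr rfl fun j _ => ?_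
    ring
  rw [h', h]
  ring

theorem posSemidef_of_frob_nonneg {A : Matrix (Fin k) (Fin k) ℝ} (hA : A.IsHermitian)
    (h : ∀ v : Fin k → ℝ, 0 ≤ frob A (Matrix.vecMulVec v v)) : A.PosSemidef := by
  refine Matrix.PosSemidef.of_dotProduct_mulVec_nonneg hA fun v => ?_
  have hv : star v ⬝ᵥ A.mulVec v = frob A (Matrix.vecMulVec v v) := by
    simp only [frob, dotProduct, Matrix.mulVec, Matrix.vecMulVec_apply, Finset.mul_sum,
      star_trivial]
    refine Finset.sum_congr rfl fun i _ => Finset.sum_congr rfl fun j _ => ?_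
    ring
  rw [hv]
  exact h v

theorem isHermitian_tensorSq (x : EuclideanSpace ℝ (Fin k)) : (tensorSq x).IsHermitian := by
  ext i j
  simp [tensorSq, mul_comm]

/-! ### The moment set and its support function. -/

/-- The space in which the first and second moments take their values. -/
abbrev MomentSpace (k : ℕ) : Type := EuclideanSpace ℝ (Fin k) × (Fin k → Fin k → ℝ)

/-- The integrand whose expectation is the pair of first and second moments. -/
def momentMap (Ξ : Set (EuclideanSpace ℝ (Fin k))) (μ₀ : EuclideanSpace ℝ (Fin k)) (ξ : Ξ) :
    MomentSpace k :=
  ((ξ : EuclideanSpace ℝ (Fin k)),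
    fun i j => tensorSq ((ξ : EuclideanSpace ℝ (Fin k)) - μ₀) i j)

/-- The admissible values of the first and second moments. -/
def momentSet (μ₀ : EuclideanSpace ℝ (Fin k)) (C₀ : Matrix (Fin k) (Fin k) ℝ) (m₁ m₂ : ℝ) :
    Set (MomentSpace k) :=
  {p | ‖p.1 - μ₀‖ ≤ m₁ ∧ (m₂ • C₀ - Matrix.of p.2).PosSemidef}

theorem continuous_momentMap (Ξ : Set (EuclideanSpace ℝ (Fin k)))
    (μ₀ : EuclideanSpace ℝ (Fin k)) : Continuous (momentMap Ξ μ₀) := by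
  unfold momentMap tensorSq
  simp only [Matrix.of_apply]
  fun_prop

theorem convex_momentSet (μ₀ : EuclideanSpace ℝ (Fin k)) (C₀ : Matrix (Fin k) (Fin k) ℝ)
    (m₁ m₂ : ℝ) : Convex ℝ (momentSet μ₀ C₀ m₁ m₂) := by
  rintro ⟨x, M⟩ ⟨hx, hM⟩ ⟨y, N⟩ ⟨hy, hN⟩ a b ha hb hab
  refine ⟨?_, ?_⟩
  · have h := convex_closedBall μ₀ m₁ (mem_closedBall_iff_norm.2 hx) (mem_closedBall_iff_norm.2 hy)
      ha hb hab
    exact mem_closedBall_iff_norm.1 h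
  · have h : m₂ • C₀ - Matrix.of (a • (x, M) + b • (y, N)).2 =
        a • (m₂ • C₀ - Matrix.of M) + b • (m₂ • C₀ - Matrix.of N) := by
      ext i j
      simp only [Matrix.sub_apply, Matrix.add_apply, Matrix.smul_apply, Matrix.of_apply,
        Prod.smul_snd, Prod.snd_add, Pi.add_apply, Pi.smul_apply, smul_eq_mul]
      linear_combination (-(m₂ * C₀ i j)) * hab
    rw [h]
    exact (hM.smul ha).add (hN.smul hb)

theorem isClosed_momentSet (μ₀ : EuclideanSpace ℝ (Fin k)) (C₀ : Matrix (Fin k) (Fin k) ℝ)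
    (m₁ m₂ : ℝ) : IsClosed (momentSet μ₀ C₀ m₁ m₂) := by
  simp only [momentSet, Matrix.posSemidef_iff_dotProduct_mulVec, Matrix.IsHermitian.ext_iff,
    Set.ofPred_and, Set.ofPred_forall, dotProduct, Matrix.mulVec, Matrix.sub_apply,
    Matrix.smul_apply, Matrix.of_apply, star_trivial]
  refine (isClosed_le (by fun_prop) (by fun_prop)).inter (IsClosed.inter ?_ ?_)
  · exact isClosed_iInter fun i => isClosed_iInter fun j =>
      isClosed_eq (by fun_prop) (by fun_prop)
  · exact isClosed_iInter fun v => isClosed_le (by fun_prop) (by fun_prop)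

theorem integral_momentMap {Ξ : Set (EuclideanSpace ℝ (Fin k))} (μ₀ : EuclideanSpace ℝ (Fin k))
    (Q : ProbabilityMeasure Ξ) (hi : Integrable (momentMap Ξ μ₀) (Q : Measure Ξ)) :
    ∫ ξ, momentMap Ξ μ₀ ξ ∂(Q : Measure Ξ) = (mean Q, fun i j => secondMoment μ₀ Q i j) := by
  refine Prod.ext ?_ (funext fun i => funext fun j => ?_)
  · exact ((ContinuousLinearMap.fst ℝ _ _).integral_comp_comm hi).symm
  · let L : MomentSpace k →L[ℝ] ℝ :=
      (ContinuousLinearMap.proj (R := ℝ) (φ := fun _ : Fin k => ℝ) j).comp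
        ((ContinuousLinearMap.proj (R := ℝ) (φ := fun _ : Fin k => Fin k → ℝ) i).comp
          (ContinuousLinearMap.snd ℝ _ _))
    exact (L.integral_comp_comm hi).symm

/-- Every continuous linear functional on the moment space is given by a vector and a matrix. -/
theorem exists_eq_inner_add_frob (φ : MomentSpace k →L[ℝ] ℝ) :
    ∃ (p : EuclideanSpace ℝ (Fin k)) (A : Matrix (Fin k) (Fin k) ℝ),
      ∀ y M, φ (y, M) = inner ℝ p y + frob A (Matrix.of M) := by
  refine ⟨(InnerProductSpace.toDual ℝ _).symm (φ.comp (ContinuousLinearMap.inl ℝ _ _)),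
    Matrix.of fun i j => φ (0, Pi.single i (Pi.single j 1)), fun y M => ?_⟩
  rw [InnerProductSpace.toDual_symm_apply]
  have h0 : ((y, M) : MomentSpace k) = (y, 0) + (0, M) := by simp
  have h1 : M = ∑ i, ∑ j, M i j • Pi.single i (Pi.single j (1 : ℝ)) := by
    ext a b
    simp [Finset.sum_apply, Pi.single_apply, Finset.sum_ite_eq, ite_apply]
  have h2 : φ (0, M) = frob (Matrix.of fun i j => φ (0, Pi.single i (Pi.single j 1)))
      (Matrix.of M) := by
    have h3 : φ (0, M) = φ.comp (ContinuousLinearMap.inr ℝ _ _) M := rfl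
    rw [h3]
    nth_rewrite 1 [h1]
    simp only [map_sum, map_smul, frob, Matrix.of_apply, smul_eq_mul]
    exact Finset.sum_congr rfl fun i _ => Finset.sum_congr rfl fun j _ => mul_comm _ _
  rw [h0, map_add, h2]
  rfl

/-- The support function of the moment set: a functional bounded by `b` on it is represented by
dual parameters `l`, `τ` and `S`. -/
theorem exists_dual_parameters {μ₀ : EuclideanSpace ℝ (Fin k)} {C₀ : Matrix (Fin k) (Fin k) ℝ}
    (hC₀ : C₀.IsHermitian) {m₁ m₂ : ℝ} (hm₁ : 0 ≤ m₁) {φ : MomentSpace k →L[ℝ] ℝ} {b : ℝ}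
    (hb : ∀ y ∈ momentSet μ₀ C₀ m₁ m₂, φ y ≤ b) :
    ∃ (l : ℝ) (τ : EuclideanSpace ℝ (Fin k)) (S : Matrix (Fin k) (Fin k) ℝ),
      0 ≤ l ∧ ‖τ‖ ≤ 1 ∧ S.PosSemidef ∧ l * m₁ - l * inner ℝ τ μ₀ + m₂ * frob S C₀ ≤ b ∧
      ∀ (Ξ : Set (EuclideanSpace ℝ (Fin k))) (ξ : Ξ), φ (momentMap Ξ μ₀ ξ) =
        frob S (tensorSq ((ξ : EuclideanSpace ℝ (Fin k)) - μ₀))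
          - l * inner ℝ τ (ξ : EuclideanSpace ℝ (Fin k)) := by
  obtain ⟨p, A, hφ⟩ := exists_eq_inner_add_frob φ
  let S : Matrix (Fin k) (Fin k) ℝ := (2⁻¹ : ℝ) • (A + A.transpose)
  have hS : S.IsHermitian := by
    ext i j
    simp [S, add_comm]
  -- For `p = 0` the convention `0⁻¹ = 0` gives `τ = 0`, so no separate witness is needed.
  have hlτ : ∀ y, ‖p‖ * inner ℝ (-(‖p‖⁻¹ • p)) y = -inner ℝ p y := fun y => by
    rcases eq_or_ne p 0 with rfl | hp
    · simp
    · rw [inner_neg_left, real_inner_smul_left, mul_neg, mul_inv_cancel_left₀ (norm_ne_zero_iff.2 hp)]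
  -- The maximizer of `inner ℝ p` over the ball; it produces the terms in `l`.
  have hball : ∃ y, ‖y - μ₀‖ ≤ m₁ ∧ inner ℝ p y = ‖p‖ * m₁ + inner ℝ p μ₀ := by
    refine ⟨(m₁ * ‖p‖⁻¹) • p + μ₀, ?_, ?_⟩
    · rw [add_sub_cancel_right, norm_smul, norm_mul, norm_inv, norm_norm,
        Real.norm_of_nonneg hm₁, mul_assoc]
      exact mul_le_of_le_one_right hm₁ inv_mul_le_one
    · rw [inner_add_right, real_inner_smul_right, real_inner_self_eq_norm_sq]
      rcases eq_or_ne p 0 with rfl | hp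
      · simp
      · have := norm_ne_zero_iff.2 hp
        field_simp
  obtain ⟨y, hy, hpy⟩ := hball
  have hbound : ∀ N : Matrix (Fin k) (Fin k) ℝ, N.PosSemidef →
      ‖p‖ * m₁ + inner ℝ p μ₀ + m₂ * frob S C₀ - frob S N ≤ b := fun N hN => by
    have h := hb (y, Matrix.of.symm (m₂ • C₀ - N)) ⟨hy, by simpa using hN⟩
    have hH : (m₂ • C₀ - N).IsHermitian := by
      refine Matrix.IsHermitian.sub ?_ hN.isHermitian
      rw [Matrix.IsHermitian, Matrix.conjTranspose_smul, hC₀.eq, star_trivial]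
    rw [hφ, hpy, Equiv.apply_symm_apply, ← frob_symm_part hH, frob_sub_right,
      frob_smul_right] at h
    simp only [S]
    linarith
  refine ⟨‖p‖, -(‖p‖⁻¹ • p), S, norm_nonneg _, ?_, ?_, ?_, fun Ξ ξ => ?_⟩
  · rw [norm_neg, norm_smul, norm_inv, norm_norm]
    exact inv_mul_le_one
  · refine posSemidef_of_frob_nonneg hS fun v => ?_
    by_contra! hneg
    set q := frob S (Matrix.vecMulVec v v) with hq
    set K := ‖p‖ * m₁ + inner ℝ p μ₀ + m₂ * frob S C₀ with hK
    have hKb : K ≤ b := by simpa [frob] using hbound 0 Matrix.PosSemidef.zero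
    -- Subtracting a positive semi-definite matrix keeps the second moment admissible. With this
    -- multiple of `vecMulVec v v`, the left side of `hbound` becomes `b + 1`.
    have ht : 0 ≤ (b - K + 1) / -q := div_nonneg (by linarith) (by linarith)
    have hv : (Matrix.vecMulVec v v).PosSemidef := by
      simpa using Matrix.posSemidef_vecMulVec_self_star v
    have h := hbound _ (hv.smul ht)
    rw [frob_smul_right, ← hq] at h
    have h1 : (b - K + 1) / -q * q = -(b - K + 1) := by
      rw [div_neg, neg_mul, div_mul_cancel₀ _ hneg.ne]
    linarith
  · rw [hlτ]
    have := hbound 0 Matrix.PosSemidef.zero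
    simp only [frob, Matrix.zero_apply, mul_zero, Finset.sum_const_zero] at this ⊢
    linarith
  · rw [momentMap, hφ, hlτ, sub_neg_eq_add, add_comm, frob_symm_part (isHermitian_tensorSq _)]
    rfl

/-! ### Weak and strong duality for the moment problem. -/

theorem isProbabilityMeasure_refLaw {Ξ : Set (EuclideanSpace ℝ (Fin k))} (hΞ : IsCompact Ξ)
    (hvol : 0 < volume Ξ) (μ₀ : EuclideanSpace ℝ (Fin k)) (C₀ : Matrix (Fin k) (Fin k) ℝ) :
    IsProbabilityMeasure (refLaw Ξ μ₀ C₀) := by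
  have huniv : Measure.comap ((↑) : Ξ → EuclideanSpace ℝ (Fin k)) volume Set.univ = volume Ξ := by
    rw [comap_subtype_coe_apply hΞ.measurableSet, Set.image_univ, Subtype.range_coe]
  have hfin : IsFiniteMeasure (Measure.comap ((↑) : Ξ → EuclideanSpace ℝ (Fin k)) volume) :=
    ⟨by rw [huniv]; exact hΞ.measure_lt_top⟩
  have hne : NeZero (Measure.comap ((↑) : Ξ → EuclideanSpace ℝ (Fin k)) volume) :=
    ⟨fun h => hvol.ne' (by rw [← huniv, h]; rfl)⟩
  have : CompactSpace Ξ := isCompact_iff_compactSpace.1 hΞ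
  have hc : Continuous fun ξ : Ξ => gaussianExponent μ₀ C₀ (ξ : EuclideanSpace ℝ (Fin k)) := by
    unfold gaussianExponent
    fun_prop
  obtain ⟨B, hB⟩ := isCompact_univ.exists_bound_of_continuousOn hc.continuousOn
  exact isProbabilityMeasure_tilted
    (integrable_exp_of_bound hc.aestronglyMeasurable fun ξ => hB ξ trivial)

theorem primalValue_eq_bot {Ξ : Set (EuclideanSpace ℝ (Fin k))} {μ₀ : EuclideanSpace ℝ (Fin k)}
    {C₀ : Matrix (Fin k) (Fin k) ℝ} {ε : ℝ} (hε : 0 < ε) (f : Ξ → ℝ) {Q : ProbabilityMeasure Ξ}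
    (hQ : klDiv (Q : Measure Ξ) (refLaw Ξ μ₀ C₀) = ⊤) : primalValue μ₀ C₀ ε f Q = ⊥ := by
  rw [primalValue, entropy, hQ, EReal.coe_ennreal_top, EReal.coe_mul_top_of_pos hε,
    EReal.sub_top]

theorem primalValue_eq_penalizedMean {Ξ : Set (EuclideanSpace ℝ (Fin k))}
    {μ₀ : EuclideanSpace ℝ (Fin k)} {C₀ : Matrix (Fin k) (Fin k) ℝ}
    [IsProbabilityMeasure (refLaw Ξ μ₀ C₀)] (ε : ℝ) (f : Ξ → ℝ) {Q : ProbabilityMeasure Ξ}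
    (hQ : klDiv (Q : Measure Ξ) (refLaw Ξ μ₀ C₀) ≠ ⊤) :
    primalValue μ₀ C₀ ε f Q =
      (penalizedMean f ε (densityOf (Q : Measure Ξ) (refLaw Ξ μ₀ C₀)) : ℝ) := by
  have hac := (klDiv_ne_top_iff.1 hQ).1
  rw [primalValue, entropy, penalizedMean, integral_densityOf_smul hac,
    integral_klFun_densityOf hac, EReal.coe_sub, EReal.coe_mul, EReal.coe_ennreal_toReal hQ]

theorem integral_smul_div_sub_entropy {Ω : Type*} [MeasurableSpace Ω] {μ : Measure Ω}
    {f g : Ω → ℝ} (hf : AEStronglyMeasurable f μ) {B : ℝ} (hB : ∀ x, ‖f x‖ ≤ B)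
    (hg : AEStronglyMeasurable g μ) {B' : ℝ} (hB' : ∀ x, ‖g x‖ ≤ B') {ε : ℝ} (hε : ε ≠ 0)
    (ρ : Ω →₁[μ] ℝ) :
    ε * (∫ x, ρ x • ((f x - g x) / ε) ∂μ - ∫ x, klFun (ρ x) ∂μ) =
      penalizedMean f ε ρ - ∫ x, ρ x • g x ∂μ := by
  have h : ∫ x, ρ x • ((f x - g x) / ε) ∂μ =
      (∫ x, ρ x • f x ∂μ - ∫ x, ρ x • g x ∂μ) / ε := by
    rw [← integral_sub (integrable_coe_smul hf hB ρ) (integrable_coe_smul hg hB' ρ),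
      ← integral_div]
    simp only [smul_eq_mul]
    congr 1
    ext x
    ring
  rw [h, penalizedMean]
  field_simp
  ring

/-- Weak duality. -/
theorem primalValue_le_dualValue {Ξ : Set (EuclideanSpace ℝ (Fin k))} (hΞ : IsCompact Ξ)
    {f : Ξ → ℝ} (hf : Continuous f) {μ₀ : EuclideanSpace ℝ (Fin k)}
    {C₀ : Matrix (Fin k) (Fin k) ℝ} [IsProbabilityMeasure (refLaw Ξ μ₀ C₀)]
    {m₁ m₂ ε : ℝ} (hε : 0 < ε) {Q : ProbabilityMeasure Ξ} (hQ : Q ∈ ambiguitySet Ξ μ₀ C₀ m₁ m₂)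
    {l : ℝ} (hl : 0 ≤ l) {τ : EuclideanSpace ℝ (Fin k)} (hτ : ‖τ‖ ≤ 1)
    {S : Matrix (Fin k) (Fin k) ℝ} (hS : S.PosSemidef) :
    primalValue μ₀ C₀ ε f Q ≤ (dualValue μ₀ C₀ m₁ m₂ ε f l τ S : ℝ) := by
  by_cases hkl : klDiv (Q : Measure Ξ) (refLaw Ξ μ₀ C₀) = ⊤
  · rw [primalValue_eq_bot hε f hkl]
    exact bot_le
  have : CompactSpace Ξ := isCompact_iff_compactSpace.1 hΞ
  have hac := (klDiv_ne_top_iff.1 hkl).1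
  have hgc := continuous_momentMap Ξ μ₀
  have hgi : Integrable (momentMap Ξ μ₀) (Q : Measure Ξ) := by
    obtain ⟨B, hB⟩ := isCompact_univ.exists_bound_of_continuousOn hgc.continuousOn
    exact Integrable.of_bound hgc.aestronglyMeasurable B
      (Filter.Eventually.of_forall fun ξ => hB ξ trivial)
  -- As a continuous linear map, the penalty commutes with the integral, so its mean depends on the
  -- moments only.
  let ψ : MomentSpace k →L[ℝ] ℝ := LinearMap.toContinuousLinearMap
    { toFun := fun p => frob S (Matrix.of p.2) - l * inner ℝ τ p.1
      map_add' := fun p q => by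
        simp only [frob, Matrix.of_apply, Prod.snd_add, Prod.fst_add, Pi.add_apply, mul_add,
          Finset.sum_add_distrib, inner_add_right]
        ring
      map_smul' := fun c p => by
        simp only [frob, Matrix.of_apply, Prod.smul_snd, Prod.smul_fst, Pi.smul_apply,
          smul_eq_mul, real_inner_smul_right, RingHom.id_apply, mul_sub, Finset.mul_sum]
        congr 1
        · refine Finset.sum_congr rfl fun i _ => Finset.sum_congr rfl fun j _ => ?_
          ring
        · ring }
  have hψ : ∀ p, ψ p = frob S (Matrix.of p.2) - l * inner ℝ τ p.1 := fun p => rfl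
  have hψc : Continuous fun ξ => ψ (momentMap Ξ μ₀ ξ) := ψ.continuous.comp hgc
  obtain ⟨B, hB⟩ := isCompact_univ.exists_bound_of_continuousOn hf.continuousOn
  obtain ⟨B', hB'⟩ := isCompact_univ.exists_bound_of_continuousOn hψc.continuousOn
  have hhc : Continuous fun ξ => (f ξ - ψ (momentMap Ξ μ₀ ξ)) / ε := (hf.sub hψc).div_const ε
  obtain ⟨B'', hB''⟩ := isCompact_univ.exists_bound_of_continuousOn hhc.continuousOn
  have hG := integral_sub_entropy_le_log_integral_exp (μ := refLaw Ξ μ₀ C₀)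
    hhc.aestronglyMeasurable (fun ξ => hB'' ξ trivial) (densityOf_mem_entropyDensities hkl)
  have hG' := mul_le_mul_of_nonneg_left hG hε.le
  rw [integral_smul_div_sub_entropy hf.aestronglyMeasurable (fun ξ => hB ξ trivial)
    hψc.aestronglyMeasurable (fun ξ => hB' ξ trivial) hε.ne',
    integral_densityOf_smul hac, ψ.integral_comp_comm hgi, integral_momentMap μ₀ Q hgi,
    hψ] at hG'
  rw [primalValue_eq_penalizedMean ε f hkl, EReal.coe_le_coe_iff, dualValue]
  have h1 : frob S (secondMoment μ₀ Q) ≤ m₂ * frob S C₀ := by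
    have := frob_nonneg hS hQ.2
    rw [frob_sub_right, frob_smul_right] at this
    linarith
  have h2 : l * inner ℝ τ μ₀ - l * m₁ ≤ l * inner ℝ τ (mean Q) := by
    have h3 : |inner ℝ τ (mean Q - μ₀)| ≤ m₁ := (abs_real_inner_le_norm _ _).trans
      ((mul_le_of_le_one_left (norm_nonneg _) hτ).trans hQ.1)
    have h4 := mul_le_mul_of_nonneg_left (abs_le.1 h3).1 hl
    rw [inner_sub_right] at h4
    linarith
  have h5 : ∀ ξ : Ξ, (f ξ - ψ (momentMap Ξ μ₀ ξ)) / ε =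
      (f ξ + l * inner ℝ τ (ξ : EuclideanSpace ℝ (Fin k))
        - frob S (tensorSq ((ξ : EuclideanSpace ℝ (Fin k)) - μ₀))) / ε := fun ξ => by
    rw [hψ, ← sub_add, sub_add_eq_add_sub]
    rfl
  simp only [h5] at hG'
  have h6 : Matrix.of (fun i j => secondMoment μ₀ Q i j) = secondMoment μ₀ Q := rfl
  rw [h6] at hG'
  linarith

/-- Strong duality: every strict upper bound of the primal values is attained by the dual. -/
theorem exists_dualValue_le {Ξ : Set (EuclideanSpace ℝ (Fin k))} (hΞ : IsCompact Ξ)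
    {f : Ξ → ℝ} (hf : Continuous f) {μ₀ : EuclideanSpace ℝ (Fin k)}
    {C₀ : Matrix (Fin k) (Fin k) ℝ} (hC₀ : C₀.IsHermitian)
    [IsProbabilityMeasure (refLaw Ξ μ₀ C₀)] {m₁ m₂ ε : ℝ} (hm₁ : 0 ≤ m₁) (hε : 0 < ε) {c : ℝ}
    (hc : ∀ Q ∈ ambiguitySet Ξ μ₀ C₀ m₁ m₂, primalValue μ₀ C₀ ε f Q < c) :
    ∃ (l : ℝ) (τ : EuclideanSpace ℝ (Fin k)) (S : Matrix (Fin k) (Fin k) ℝ),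
      0 ≤ l ∧ ‖τ‖ ≤ 1 ∧ S.PosSemidef ∧ dualValue μ₀ C₀ m₁ m₂ ε f l τ S ≤ c := by
  have : CompactSpace Ξ := isCompact_iff_compactSpace.1 hΞ
  have hgc := continuous_momentMap Ξ μ₀
  obtain ⟨B, hB⟩ := isCompact_univ.exists_bound_of_continuousOn hf.continuousOn
  obtain ⟨B', hB'⟩ := isCompact_univ.exists_bound_of_continuousOn hgc.continuousOn
  have hCn : (momentSet μ₀ C₀ m₁ m₂).Nonempty :=
    ⟨(μ₀, Matrix.of.symm (m₂ • C₀)), by simpa using hm₁,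
      by simpa using Matrix.PosSemidef.zero⟩
  obtain ⟨φ, b, hφ, hb⟩ := exists_multiplier_penalizedMean (μ := refLaw Ξ μ₀ C₀) (c := c)
    hf.aestronglyMeasurable (fun ξ => hB ξ trivial) hε hgc.aestronglyMeasurable
    (fun ξ => hB' ξ trivial) (convex_momentSet μ₀ C₀ m₁ m₂) (isClosed_momentSet μ₀ C₀ m₁ m₂) hCn
    (fun ρ hρ hρC => by
      obtain ⟨Q, hQ, rfl, hkl⟩ := exists_densityOf_eq hρ
      have hi : Integrable (momentMap Ξ μ₀) Q := Integrable.of_bound hgc.aestronglyMeasurable B'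
        (Filter.Eventually.of_forall fun ξ => hB' ξ trivial)
      rw [integral_densityOf_smul (klDiv_ne_top_iff.1 hkl).1] at hρC
      replace hρC := (integral_momentMap μ₀ ⟨Q, hQ⟩ hi) ▸ hρC
      have h := hc ⟨Q, hQ⟩ hρC
      rwa [primalValue_eq_penalizedMean (Q := ⟨Q, hQ⟩) ε f hkl, EReal.coe_lt_coe_iff] at h)
  obtain ⟨l, τ, S, hl, hτ, hS, hle, hmap⟩ := exists_dual_parameters hC₀ hm₁ hφ
  refine ⟨l, τ, S, hl, hτ, hS, ?_⟩
  have hφc : Continuous fun ξ => φ (momentMap Ξ μ₀ ξ) := φ.continuous.comp hgc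
  obtain ⟨B₁, hB₁⟩ := isCompact_univ.exists_bound_of_continuousOn hφc.continuousOn
  have hhc : Continuous fun ξ => (f ξ - φ (momentMap Ξ μ₀ ξ)) / ε := (hf.sub hφc).div_const ε
  obtain ⟨B₂, hB₂⟩ := isCompact_univ.exists_bound_of_continuousOn hhc.continuousOn
  -- The Gibbs density need not be feasible; the multiplier inequality holds for all densities of
  -- finite entropy.
  obtain ⟨ρ, hρ, hρeq⟩ := exists_integral_sub_entropy_eq_log_integral_exp (μ := refLaw Ξ μ₀ C₀)
    hhc.aestronglyMeasurable (fun ξ => hB₂ ξ trivial)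
  have h1 := integral_smul_div_sub_entropy hf.aestronglyMeasurable (fun ξ => hB ξ trivial)
    hφc.aestronglyMeasurable (fun ξ => hB₁ ξ trivial) hε.ne' ρ
  have h2 : ∫ ξ, ρ ξ • φ (momentMap Ξ μ₀ ξ) ∂(refLaw Ξ μ₀ C₀) =
      φ (∫ ξ, ρ ξ • momentMap Ξ μ₀ ξ ∂(refLaw Ξ μ₀ C₀)) := by
    rw [← φ.integral_comp_comm
      (integrable_coe_smul hgc.aestronglyMeasurable (fun ξ => hB' ξ trivial) ρ)]
    simp only [map_smul]
  have h3 := hb ρ hρ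
  rw [hρeq, h2] at h1
  rw [← h1] at h3
  have h5 : ∀ ξ : Ξ, (f ξ - φ (momentMap Ξ μ₀ ξ)) / ε =
      (f ξ + l * inner ℝ τ (ξ : EuclideanSpace ℝ (Fin k))
        - frob S (tensorSq ((ξ : EuclideanSpace ℝ (Fin k)) - μ₀))) / ε := fun ξ => by
    rw [hmap, ← sub_add, sub_add_eq_add_sub]
  simp only [h5] at h3
  rw [dualValue]
  linarith

end MomentDRO

theorem proposition2p2 {k : ℕ} (Ξ : Set (EuclideanSpace ℝ (Fin k))) (hΞ : IsCompact Ξ)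
    (hvol : 0 < MeasureTheory.volume Ξ) (f : Ξ → ℝ) (hf : Continuous f)
    (μ₀ : EuclideanSpace ℝ (Fin k)) (C₀ : Matrix (Fin k) (Fin k) ℝ) (hC₀ : C₀.PosDef)
    (m₁ m₂ ε : ℝ) (hm₁ : 0 < m₁) (hm₂ : 0 < m₂) (hε : 0 < ε) :
    (⨆ Q ∈ MomentDRO.ambiguitySet Ξ μ₀ C₀ m₁ m₂, MomentDRO.primalValue μ₀ C₀ ε f Q) =
      ⨅ (l : ℝ) (_ : 0 ≤ l) (τ : EuclideanSpace ℝ (Fin k)) (_ : ‖τ‖ ≤ 1)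
        (S : Matrix (Fin k) (Fin k) ℝ) (_ : S.PosSemidef),
        (MomentDRO.dualValue μ₀ C₀ m₁ m₂ ε f l τ S : EReal) := by
  have := MomentDRO.isProbabilityMeasure_refLaw hΞ hvol μ₀ C₀
  refine le_antisymm ?_ ?_
  · exact iSup₂_le fun Q hQ => le_iInf₂ fun l hl => le_iInf₂ fun τ hτ => le_iInf₂ fun S hS =>
      MomentDRO.primalValue_le_dualValue hΞ hf hε hQ hl hτ hS
  -- This also covers an empty ambiguity set: the supremum is then `⊥`, every real `c` qualifies,
  -- and the infimum is `⊥`.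
  · refine le_of_forall_gt_imp_ge_of_dense fun c hc => ?_
    induction c with
    | bot => exact absurd hc not_lt_bot
    | top => exact le_top
    | coe c =>
      obtain ⟨l, τ, S, hl, hτ, hS, hle⟩ := MomentDRO.exists_dualValue_le hΞ hf hC₀.isHermitian
        hm₁.le hε fun Q hQ =>
          (le_iSup₂ (f := fun Q _ => MomentDRO.primalValue μ₀ C₀ ε f Q) Q hQ).trans_lt hc
      exact (iInf₂_le_of_le l hl <| iInf₂_le_of_le τ hτ <| iInf₂_le S hS).trans
        (EReal.coe_le_coe_iff.2 hle)
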